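/- Let $A$ be a noetherian Krull domain, that is, a noetherian integral domain such that $A=\bigcap_{\mathfrak p}A_{\mathfrak p}$ (intersection in the fraction field of $A$, over all primes $\mathfrak p$ of height $1$), every such $A_{\mathfrak p}$ is a discrete valuation ring, and every nonzero $x\in A$ is a unit in $A_{\mathfrak p}$ for all but finitely many $\mathfrak p$ of height $1$. A finitely generated torsion module over such a ring is called pseudo-null if its annihilator has height at least $2$ (the unit ideal having height $\infty$), and a pseudo-isomorphism is a homomorphism with pseudo-null kernel and cokernel. The characteristic ideal $Ch_A(M)$ of a finitely generated $A$-module $M$ is $0$ if $M$ is not torsion; if $M$ is torsion, then $Ch_A(M)=\prod_{i=1}^n\mathfrak p_i^{e_i}$, where $M\to\bigoplus_{i=1}^n A/\mathfrak p_i^{e_i}$ is a pseudo-isomorphism with $\mathfrak p_i$ (not necessarily distinct) primes of height $1$ and $e_i\ge 1$; such a pseudo-isomorphism exists, and the pairs $(\mathfrak p_i,e_i)$ are unique up to order. Let $B=A[[t]]$ be the ring of power series in one variable over $A$ (again a noetherian Krull domain), and let $P$ be a pseudo-null $B$-module. Write $P_t=\{x\in P: tx=0\}$. Then $P_t$ and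 $P/tP$ are finitely generated torsion $A$-modules, and $$Ch_A(P_t)=Ch_A(P/tP).$$ -/

import Mathlib

open scoped PowerSeries Pointwise

/-- An integral domain `A` is a Krull domain if it is the intersection, inside its fraction field,
of its localizations at the primes of height one, all these localizations are discrete valuation
rings, and every nonzero element of `A` is a unit in all but finitely many of them. -/
class IsKrullDomain (A : Type*) [CommRing A] [IsDomain A] : Prop where
  iInf_localization_eq_bot :
    (⨅ p : {p : PrimeSpectrum A // p.asIdeal.height = 1},
      Localization.subalgebra.ofField (FractionRing A) p.1.asIdeal.primeCompl
        p.1.asIdeal.primeCompl_le_nonZeroDivisors) = (⊥ : Subalgebra A (FractionRing A))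
  isDiscreteValuationRing : ∀ p : PrimeSpectrum A, p.asIdeal.height = 1 →
    IsDiscreteValuationRing (Localization.AtPrime p.asIdeal)
  finite_not_isUnit : ∀ x : A, x ≠ 0 →
    {p : PrimeSpectrum A | p.asIdeal.height = 1 ∧
      ¬ IsUnit (algebraMap A (Localization.AtPrime p.asIdeal) x)}.Finite

/-- A pseudo-null module is a finitely generated torsion module whose annihilator has height at
least 2 (the unit ideal has height `⊤`, so the zero module is pseudo-null). -/
structure IsPseudoNull (A M : Type*) [CommRing A] [AddCommGroup M] [Module A M] : Prop where
  finite : Module.Finite A M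
  isTorsion : Module.IsTorsion A M
  two_le_height : 2 ≤ (Module.annihilator A M).height

/-- A pseudo-isomorphism is a linear map with pseudo-null kernel and cokernel. -/
structure IsPseudoIsomorphism {A M N : Type*} [CommRing A] [AddCommGroup M] [Module A M]
    [AddCommGroup N] [Module A N] (f : M →ₗ[A] N) : Prop where
  ker : IsPseudoNull A (LinearMap.ker f)
  coker : IsPseudoNull A (N ⧸ LinearMap.range f)

/-- There is a pseudo-isomorphism from `M` to an elementary module `⨁ i, A ⧸ (p i) ^ (e i)`, where
the `p i` are (not necessarily distinct) primes of height one, and `I` is the product of the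
`(p i) ^ (e i)`. -/
def IsElementaryProduct (A M : Type*) [CommRing A] [AddCommGroup M] [Module A M]
    (I : Ideal A) : Prop :=
  ∃ (n : ℕ) (p : Fin n → Ideal A) (e : Fin n → ℕ),
    (∀ i, (p i).IsPrime ∧ (p i).height = 1 ∧ 0 < e i) ∧
    (∃ f : M →ₗ[A] ((i : Fin n) → A ⧸ (p i) ^ (e i)), IsPseudoIsomorphism f) ∧
    I = ∏ i, (p i) ^ (e i)

open Classical in
/-- The characteristic ideal of a finitely generated module `M` over a noetherian Krull domain `A`:
it is `0` if `M` is not torsion, and `∏ (p i) ^ (e i)` if `M` is pseudo-isomorphic to the elementary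
module `⨁ i, A ⧸ (p i) ^ (e i)`. (Over a noetherian Krull domain, every finitely generated torsion
module is pseudo-isomorphic to an elementary module, whose pairs `(p i, e i)` are uniquely
determined up to order.) -/
noncomputable def charIdeal (A M : Type*) [CommRing A] [AddCommGroup M] [Module A M] : Ideal A :=
  if h : Module.IsTorsion A M ∧ ∃ I, IsElementaryProduct A M I then h.2.choose else ⊥

/-! ### Lengths of localizations and their additivity. -/

section LocalLength

variable {A : Type*} [CommRing A] (p : Ideal A) [p.IsPrime]

/-! For a prime `p` of height one, the length of `M_p` vanishes on pseudo-null modules, so it is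
invariant under pseudo-isomorphism. On an elementary module it is the total exponent of `p`. Local
lengths at height-one primes therefore determine the characteristic ideal
(`IsElementaryProduct.eq_of_localLength_eq`), and it suffices to show that `P_t` and `P/tP` have
equal length at each such `p`.

By the snake lemma, the difference of these two lengths is additive in short exact sequences
(`localLength_torsionBy_add_quotSMul`). A prime filtration over the noetherian ring `A⟦X⟧` then
reduces the claim to `A⟦X⟧ ⧸ q` with `q` prime of height at least 2. If `X ∈ q`, kernel and cokernel
of `X` are both the whole module. If `X ∉ q`, the kernel is zero. Moreover `q` cannot lie in the
prime `(p, X)`: the inclusion would be strict, while `(p, X)` has height at most 2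
(`height_comap_constantCoeff_le_two`). So some element of `q` has constant term outside `p`, and it
kills the cokernel locally at `p`.

Additivity is useful only if lengths can be cancelled in `ℕ∞`. Their finiteness comes from the
structure theorem `exists_isElementaryProduct`, which also ensures that `charIdeal` takes its
intended value. -/

/-- The length of the localization of a module at a prime. -/
noncomputable def localLength (M : Type*) [AddCommGroup M] [Module A M] : ℕ∞ :=
  Module.length (Localization.AtPrime p) (LocalizedModule p.primeCompl M)

variable {M N Q : Type*} [AddCommGroup M] [Module A M] [AddCommGroup N] [Module A N]
  [AddCommGroup Q] [Module A Q]

theorem localLength_eq_add_of_exact {f : M →ₗ[A] N} {g : N →ₗ[A] Q} (hf : Function.Injective f)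
    (hg : Function.Surjective g) (h : Function.Exact f g) :
    localLength p N = localLength p M + localLength p Q :=
  Module.length_eq_add_of_exact (LocalizedModule.map p.primeCompl f)
    (LocalizedModule.map p.primeCompl g) (LocalizedModule.map_injective _ f hf)
    (LocalizedModule.map_surjective _ g hg) (LocalizedModule.map_exact _ f g h)

theorem localLength_eq_zero (h : ∀ m : M, ∃ s ∉ p, s • m = 0) : localLength p M = 0 :=
  Module.length_eq_zero_iff.mpr (LocalizedModule.subsingleton_iff.mpr h)

theorem localLength_congr (e : M ≃ₗ[A] N) : localLength p M = localLength p N := by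
  have h := localLength_eq_add_of_exact p (f := (0 : PUnit →ₗ[A] M)) (g := e.toLinearMap)
    (fun _ _ _ ↦ rfl) e.surjective (fun x ↦ ⟨fun hx ↦ ⟨0, (e.map_eq_zero_iff.mp hx).symm⟩, by rintro ⟨y, rfl⟩; exact e.map_zero⟩)
  rwa [localLength_eq_zero p (M := PUnit) fun _ ↦ ⟨1, p.primeCompl.one_mem, rfl⟩, zero_add] at h

theorem localLength_eq_ker_add_range (f : M →ₗ[A] N) :
    localLength p M = localLength p (LinearMap.ker f) + localLength p (LinearMap.range f) :=
  localLength_eq_add_of_exact p (f := (LinearMap.ker f).subtype) (g := f.rangeRestrict)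
    (Submodule.subtype_injective _) f.surjective_rangeRestrict
    (by rw [LinearMap.exact_iff, Submodule.range_subtype, LinearMap.ker_rangeRestrict])

theorem localLength_eq_range_add_coker (f : M →ₗ[A] N) :
    localLength p N = localLength p (LinearMap.range f) + localLength p (N ⧸ LinearMap.range f) :=
  localLength_eq_add_of_exact p (f := (LinearMap.range f).subtype) (g := (LinearMap.range f).mkQ)
    (Submodule.subtype_injective _) (Submodule.mkQ_surjective _)
    (by rw [LinearMap.exact_iff, Submodule.range_subtype, Submodule.ker_mkQ])

/-- The alternating sum of the local lengths in a six-term exact sequence vanishes. -/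
theorem localLength_six_term {X₁ X₂ X₃ X₄ X₅ X₆ : Type*}
    [AddCommGroup X₁] [Module A X₁] [AddCommGroup X₂] [Module A X₂] [AddCommGroup X₃] [Module A X₃]
    [AddCommGroup X₄] [Module A X₄] [AddCommGroup X₅] [Module A X₅] [AddCommGroup X₆] [Module A X₆]
    {f₁ : X₁ →ₗ[A] X₂} {f₂ : X₂ →ₗ[A] X₃} {f₃ : X₃ →ₗ[A] X₄} {f₄ : X₄ →ₗ[A] X₅} {f₅ : X₅ →ₗ[A] X₆}
    (h₁ : Function.Injective f₁) (h₁₂ : Function.Exact f₁ f₂) (h₂₃ : Function.Exact f₂ f₃)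
    (h₃₄ : Function.Exact f₃ f₄) (h₄₅ : Function.Exact f₄ f₅) (h₅ : Function.Surjective f₅) :
    localLength p X₁ + localLength p X₃ + localLength p X₅ =
      localLength p X₂ + localLength p X₄ + localLength p X₆ := by
  rw [localLength_eq_ker_add_range p f₂, localLength_eq_ker_add_range p f₃,
    localLength_eq_ker_add_range p f₄, localLength_eq_ker_add_range p f₅,
    LinearMap.exact_iff.mp h₁₂, LinearMap.exact_iff.mp h₂₃, LinearMap.exact_iff.mp h₃₄,
    LinearMap.exact_iff.mp h₄₅, LinearMap.range_eq_top.mpr h₅,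
    localLength_congr p (LinearEquiv.ofInjective f₁ h₁),
    localLength_congr p (Submodule.topEquiv (R := A) (M := X₆))]
  ring

theorem localLength_pi {ι : Type*} [Fintype ι] (N : ι → Type*) [∀ i, AddCommGroup (N i)]
    [∀ i, Module A (N i)] : localLength p (∀ i, N i) = ∑ i, localLength p (N i) := by
  let e := IsLocalizedModule.linearEquiv p.primeCompl
    (LocalizedModule.mkLinearMap p.primeCompl (∀ i, N i))
    (.pi fun i ↦ LocalizedModule.mkLinearMap p.primeCompl (N i) ∘ₗ .proj i)
  unfold localLength
  rw [(e.extendScalarsOfIsLocalization p.primeCompl (Localization.AtPrime p)).length_eq,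
    Module.length_pi_of_fintype]

end LocalLength

/-! ### Local lengths of the cyclic modules `A ⧸ q ^ e`. -/

section LocalLengthQuotient

variable {A : Type*} [CommRing A]

/-- Distinct primes of height one are incomparable, as a strict inclusion would raise the height;
primality of `p` extends this to powers of `q`. -/
theorem exists_mem_pow_notMem {p q : Ideal A} [p.IsPrime] [q.IsPrime] (hp : p.height = 1)
    (hq : q.height = 1) (h : q ≠ p) (e : ℕ) : ∃ s ∈ q ^ e, s ∉ p := by
  by_contra! H
  refine h ?_
  have hqp : q ≤ p := fun x hx ↦ Ideal.IsPrime.mem_of_pow_mem ‹_› e (H _ (Ideal.pow_mem_pow hx e))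
  by_contra hne
  have := Ideal.height_add_one_le_of_lt_of_isPrime (lt_of_le_of_ne hqp hne)
  rw [hp, hq] at this
  exact absurd this (by norm_num)

theorem localLength_quotient_pow_of_ne {p q : Ideal A} [p.IsPrime] [q.IsPrime] (hp : p.height = 1)
    (hq : q.height = 1) (h : q ≠ p) (e : ℕ) : localLength p (A ⧸ q ^ e) = 0 := by
  obtain ⟨s, hs, hsp⟩ := exists_mem_pow_notMem hp hq h e
  refine localLength_eq_zero p fun m ↦ ⟨s, hsp, ?_⟩
  obtain ⟨a, rfl⟩ := Ideal.Quotient.mk_surjective m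
  rw [← Ideal.Quotient.mk_eq_mk, ← Submodule.Quotient.mk_smul, Submodule.Quotient.mk_eq_zero]
  exact Ideal.mul_mem_right _ _ hs

/-- If `A_p` is a discrete valuation ring, then `p ^ k A_p` is generated by `ϖ ^ k`. -/
theorem localized'_pow_eq_span {p : Ideal A} [p.IsPrime]
    {ϖ : Localization.AtPrime p} (h : IsLocalRing.maximalIdeal (Localization.AtPrime p) =
      Ideal.span {ϖ}) (k : ℕ) :
    Submodule.localized' (Localization.AtPrime p) p.primeCompl
      (Algebra.linearMap A (Localization.AtPrime p)) (p ^ k) = Ideal.span {ϖ ^ k} := by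
  rw [Submodule.localized'_eq_span, ← Ideal.span_singleton_pow, ← h,
    ← Localization.AtPrime.map_eq_maximalIdeal, ← Ideal.map_pow]
  rfl

theorem localLength_quotient_pow_self [IsDomain A] {p : Ideal A} [p.IsPrime]
    [IsDiscreteValuationRing (Localization.AtPrime p)] (e : ℕ) :
    localLength p (A ⧸ p ^ e) = e := by
  obtain ⟨ϖ, hϖ⟩ := IsDiscreteValuationRing.exists_irreducible (Localization.AtPrime p)
  have hs := localized'_pow_eq_span hϖ.maximalIdeal_eq e
  let f := Submodule.toLocalizedQuotient' (Localization.AtPrime p) p.primeCompl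
      (Algebra.linearMap A (Localization.AtPrime p)) (p ^ e)
  let l := IsLocalizedModule.linearEquiv p.primeCompl
    (LocalizedModule.mkLinearMap p.primeCompl (A ⧸ p ^ e)) f
  unfold localLength
  rw [(l.extendScalarsOfIsLocalization p.primeCompl (Localization.AtPrime p)).length_eq,
    (Submodule.quotEquivOfEq _ _ hs).length_eq]
  change Ring.ord _ _ = _
  rw [Ring.ord_pow (mem_nonZeroDivisors_of_ne_zero hϖ.ne_zero), Ring.ord_of_irreducible hϖ]
  simp

end LocalLengthQuotient

/-! ### Local lengths determine the elementary product. -/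

section Invariance

variable {A : Type*} [CommRing A]

theorem IsPseudoNull.localLength_eq_zero {M : Type*} [AddCommGroup M] [Module A M]
    (h : IsPseudoNull A M) (p : Ideal A) [p.IsPrime] (hp : p.height = 1) :
    localLength p M = 0 := by
  obtain ⟨s, hs, hsp⟩ : ∃ s ∈ Module.annihilator A M, s ∉ p := by
    by_contra! H
    have := h.two_le_height.trans (Ideal.height_mono H)
    rw [hp] at this
    exact absurd this (by norm_num)
  exact _root_.localLength_eq_zero p fun m ↦ ⟨s, hsp, Module.mem_annihilator.mp hs m⟩

theorem IsPseudoIsomorphism.localLength_eq {M N : Type*} [AddCommGroup M] [Module A M]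
    [AddCommGroup N] [Module A N] {f : M →ₗ[A] N} (h : IsPseudoIsomorphism f) (p : Ideal A)
    [p.IsPrime] (hp : p.height = 1) : localLength p M = localLength p N := by
  rw [localLength_eq_ker_add_range p f, localLength_eq_range_add_coker p f,
    h.ker.localLength_eq_zero p hp, h.coker.localLength_eq_zero p hp, zero_add, add_zero]

variable [IsDomain A] [IsKrullDomain A]

theorem IsKrullDomain.isDiscreteValuationRing_of_height {p : Ideal A} [p.IsPrime]
    (hp : p.height = 1) : IsDiscreteValuationRing (Localization.AtPrime p) :=
  IsKrullDomain.isDiscreteValuationRing (⟨p, ‹_›⟩ : PrimeSpectrum A) hp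

open Classical in
theorem localLength_pi_quotient_pow {ι : Type*} [Fintype ι] {q : ι → Ideal A} {e : ι → ℕ}
    (hq : ∀ i, (q i).IsPrime ∧ (q i).height = 1) (p : Ideal A) [p.IsPrime] (hp : p.height = 1) :
    localLength p (∀ i, A ⧸ q i ^ e i) = (∑ i with q i = p, e i : ℕ) := by
  rw [localLength_pi, Finset.sum_filter, Nat.cast_sum]
  refine Finset.sum_congr rfl fun i _ ↦ ?_
  have := (hq i).1
  split_ifs with h
  · subst h
    have := IsKrullDomain.isDiscreteValuationRing_of_height hp
    exact localLength_quotient_pow_self _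
  · rw [localLength_quotient_pow_of_ne hp (hq i).2 h, Nat.cast_zero]

-- Allowing any `S` that contains all values lets two products with different index types be
-- compared over one common set; values not attained get exponent zero.
open Classical in
theorem prod_pow_eq_prod_pow_sum {R ι : Type*} [CommMonoid R] [Fintype ι] (q : ι → R) (e : ι → ℕ)
    {S : Finset R} (hS : ∀ i, q i ∈ S) :
    ∏ i, q i ^ e i = ∏ p ∈ S, p ^ ∑ i with q i = p, e i := by
  rw [← Finset.prod_fiberwise_of_maps_to (s := Finset.univ) (t := S) fun i _ ↦ hS i]
  refine Finset.prod_congr rfl fun p _ ↦ ?_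
  rw [← Finset.prod_pow_eq_pow_sum]
  exact Finset.prod_congr rfl fun i hi ↦ by rw [(Finset.mem_filter.mp hi).2]

/-- This finiteness permits cancellation in `ℕ∞` during the dévissage. -/
theorem IsElementaryProduct.localLength_ne_top {M : Type*} [AddCommGroup M] [Module A M]
    {I : Ideal A} (h : IsElementaryProduct A M I) (p : Ideal A) [p.IsPrime] (hp : p.height = 1) :
    localLength p M ≠ ⊤ := by
  obtain ⟨n, q, e, hq, ⟨f, hf⟩, -⟩ := h
  rw [hf.localLength_eq p hp, localLength_pi_quotient_pow (fun i ↦ ⟨(hq i).1, (hq i).2.1⟩) p hp]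
  exact ENat.natCast_ne_top _

open Classical in
/-- The product of prime powers attached to a module is determined by its local lengths. -/
theorem IsElementaryProduct.eq_of_localLength_eq {M N : Type*} [AddCommGroup M] [Module A M]
    [AddCommGroup N] [Module A N] {I J : Ideal A} (hI : IsElementaryProduct A M I)
    (hJ : IsElementaryProduct A N J)
    (h : ∀ (p : Ideal A) [p.IsPrime], p.height = 1 → localLength p M = localLength p N) :
    I = J := by
  obtain ⟨m, p, e, hp, ⟨f, hf⟩, rfl⟩ := hI
  obtain ⟨n, q, k, hq, ⟨g, hg⟩, rfl⟩ := hJ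
  rw [prod_pow_eq_prod_pow_sum p e (S := Finset.univ.image p ∪ Finset.univ.image q) (by simp),
    prod_pow_eq_prod_pow_sum q k (S := Finset.univ.image p ∪ Finset.univ.image q) (by simp)]
  refine Finset.prod_congr rfl fun r hr ↦ ?_
  have hr' : r.IsPrime ∧ r.height = 1 := by
    simp only [Finset.mem_union, Finset.mem_image, Finset.mem_univ, true_and] at hr
    obtain ⟨i, rfl⟩ | ⟨i, rfl⟩ := hr
    exacts [⟨(hp i).1, (hp i).2.1⟩, ⟨(hq i).1, (hq i).2.1⟩]
  have := hr'.1
  have H := h r hr'.2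
  rw [hf.localLength_eq r hr'.2, hg.localLength_eq r hr'.2,
    localLength_pi_quotient_pow (fun i ↦ ⟨(hp i).1, (hp i).2.1⟩) r hr'.2,
    localLength_pi_quotient_pow (fun i ↦ ⟨(hq i).1, (hq i).2.1⟩) r hr'.2] at H
  exact congrArg (r ^ ·) (Nat.cast_inj.mp H)

end Invariance

/-! ### Torsion modules locally at one height-one prime. -/

section Structure

/-- The structure theorem over a PID may yield zero exponents and varying irreducibles: trivial
factors are discarded, and all irreducibles of a DVR are associated to `ϖ`. -/
theorem IsDiscreteValuationRing.exists_equiv_pi_quotient_pow {R : Type*} [CommRing R] [IsDomain R]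
    [IsDiscreteValuationRing R] {ϖ : R} (hϖ : Irreducible ϖ) {M : Type*} [AddCommGroup M]
    [Module R M] [Module.Finite R M] (hM : Module.IsTorsion R M) :
    ∃ (d : ℕ) (k : Fin d → ℕ), (∀ i, 0 < k i) ∧
      Nonempty (M ≃ₗ[R] ∀ i, R ⧸ Ideal.span {ϖ ^ k i}) := by
  classical
  obtain ⟨ι, _, q, hq, e, ⟨l⟩⟩ := Module.equiv_directSum_of_isTorsion hM
  let l₁ := l ≪≫ₗ DirectSum.linearEquivFunOnFintype R ι _
  let l₂ : M →ₗ[R] ∀ i : {i // 0 < e i}, R ⧸ Submodule.span R {q i.1 ^ e i.1} :=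
    .pi fun i ↦ .proj i.1 ∘ₗ l₁.toLinearMap
  have hl₂ : Function.Bijective l₂ := by
    constructor
    · rw [injective_iff_map_eq_zero]
      intro x hx
      refine l₁.map_eq_zero_iff.mp (funext fun i ↦ ?_)
      by_cases hi : 0 < e i
      · exact congrFun hx ⟨i, hi⟩
      · obtain ⟨y, hy⟩ := Submodule.Quotient.mk_surjective _ (l₁ x i)
        rw [← hy, Pi.zero_apply, Submodule.Quotient.mk_eq_zero]
        simp [Nat.eq_zero_of_not_pos hi]
    · intro y
      refine ⟨l₁.symm fun i ↦ if hi : 0 < e i then y ⟨i, hi⟩ else 0, funext fun i ↦ ?_⟩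
      simp [l₂, i.2]
  let σ := (Fintype.equivFin {i // 0 < e i}).symm
  refine ⟨_, fun j ↦ e (σ j), fun j ↦ (σ j).2, ⟨LinearEquiv.ofBijective l₂ hl₂ ≪≫ₗ
    (LinearEquiv.piCongrLeft R (fun i : {i // 0 < e i} ↦ R ⧸ Submodule.span R {q i.1 ^ e i.1})
      σ).symm ≪≫ₗ LinearEquiv.piCongrRight fun j ↦ Submodule.quotEquivOfEq _ _ ?_⟩⟩
  exact Ideal.span_singleton_eq_span_singleton.mpr
    ((IsDiscreteValuationRing.associated_of_irreducible R (hq _) hϖ).pow_pow)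

variable {A : Type*} [CommRing A] [IsDomain A] {M : Type*} [AddCommGroup M] [Module A M]

theorem isTorsion_localizedModule {p : Ideal A} [p.IsPrime] (hM : Module.IsTorsion A M) :
    Module.IsTorsion (Localization.AtPrime p) (LocalizedModule p.primeCompl M) := by
  intro x
  induction x with
  | h m s =>
    obtain ⟨a, ha⟩ := @hM m
    refine ⟨⟨algebraMap A _ a, mem_nonZeroDivisors_of_ne_zero ?_⟩, ?_⟩
    · rw [Ne, IsLocalization.to_map_eq_zero_iff _ p.primeCompl_le_nonZeroDivisors]
      exact nonZeroDivisors.ne_zero a.2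
    · change algebraMap A (Localization.AtPrime p) a • LocalizedModule.mk m s = 0
      rw [algebraMap_smul, LocalizedModule.smul'_mk]
      rw [show (a : A) • m = 0 from ha, LocalizedModule.zero_mk]

/-- A map to an elementary module which is an isomorphism locally at a prime whose local ring is a
discrete valuation ring. -/
theorem exists_locally_bijective_of_isTorsion [IsNoetherianRing A] [Module.Finite A M]
    (hM : Module.IsTorsion A M)
    (p : Ideal A) [p.IsPrime] [IsDiscreteValuationRing (Localization.AtPrime p)] :
    ∃ (d : ℕ) (k : Fin d → ℕ) (f : M →ₗ[A] ∀ i, A ⧸ p ^ k i), (∀ i, 0 < k i) ∧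
      (∀ x, f x = 0 → ∃ s ∉ p, s • x = 0) ∧ ∀ y, ∃ s ∉ p, ∃ x, f x = s • y := by
  obtain ⟨ϖ, hϖ⟩ := IsDiscreteValuationRing.exists_irreducible (Localization.AtPrime p)
  obtain ⟨d, k, hk, ⟨l⟩⟩ := IsDiscreteValuationRing.exists_equiv_pi_quotient_pow hϖ
    (isTorsion_localizedModule (p := p) hM)
  let h : (∀ i, A ⧸ p ^ k i) →ₗ[A] ∀ i, Localization.AtPrime p ⧸ Submodule.localized'
      (Localization.AtPrime p) p.primeCompl (Algebra.linearMap A (Localization.AtPrime p))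
      (p ^ k i) :=
    .pi fun i ↦ Submodule.toLocalizedQuotient' (Localization.AtPrime p) p.primeCompl
      (Algebra.linearMap A (Localization.AtPrime p)) (p ^ k i) ∘ₗ .proj i
  have : IsLocalizedModule p.primeCompl h := IsLocalizedModule.pi _ _
  let l' := (l ≪≫ₗ LinearEquiv.piCongrRight fun i ↦ Submodule.quotEquivOfEq _ _
    (localized'_pow_eq_span hϖ.maximalIdeal_eq (k i)).symm).restrictScalars A
  have := Module.finitePresentation_of_finite A M
  -- Finite presentation allows the local isomorphism to be lifted to `A` after clearing a common
  -- denominator `s`.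
  obtain ⟨f, s, hf⟩ := Module.FinitePresentation.exists_lift_of_isLocalizedModule p.primeCompl h
    (l'.toLinearMap ∘ₗ LocalizedModule.mkLinearMap p.primeCompl M)
  have hf' (x : M) : h (f x) = s • l' (LocalizedModule.mkLinearMap p.primeCompl M x) :=
    LinearMap.congr_fun hf x
  refine ⟨d, k, f, hk, fun x hx ↦ ?_, fun y ↦ ?_⟩
  · have h0 := hf' x
    rw [hx, map_zero, eq_comm, Submonoid.smul_def, ← map_smul, ← map_smul, l'.map_eq_zero_iff,
      IsLocalizedModule.eq_zero_iff p.primeCompl] at h0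
    obtain ⟨c, hc⟩ := h0
    exact ⟨c * s, (c * s).2, by rw [mul_smul]; exact hc⟩
  · obtain ⟨⟨x, t⟩, hx⟩ := IsLocalizedModule.surj p.primeCompl
      (LocalizedModule.mkLinearMap p.primeCompl M) (l'.symm (h y))
    have h1 : h (f x) = h ((s * t : p.primeCompl) • y) := by
      rw [hf', ← hx]
      simp only [Submonoid.smul_def, map_smul, l'.apply_symm_apply, mul_smul]
    obtain ⟨c, hc⟩ := IsLocalizedModule.exists_of_eq (S := p.primeCompl) h1
    refine ⟨c * (s * t), (c * (s * t)).2, (c : A) • x, ?_⟩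
    rw [map_smul, mul_smul]
    exact hc

end Structure

/-! ### Pseudo-isomorphisms to elementary modules. -/

section Existence

variable {A : Type*} [CommRing A] [IsDomain A] {M : Type*} [AddCommGroup M] [Module A M]

theorem exists_ne_zero_mem_annihilator [Module.Finite A M] (hM : Module.IsTorsion A M) :
    ∃ a ∈ Module.annihilator A M, a ≠ 0 := by
  obtain ⟨a, ha, ha'⟩ := Submodule.annihilator_top_inter_nonZeroDivisors hM
  exact ⟨a, by rwa [SetLike.mem_coe, Submodule.annihilator_top] at ha, nonZeroDivisors.ne_zero ha'⟩

/-- A minimal prime of the annihilator lies in the support. Its height is not 0, since the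
annihilator is nonzero in a domain, and not 1 by `h`. -/
theorem isPseudoNull_of_locally_zero [Module.Finite A M] (hM : Module.IsTorsion A M)
    (h : ∀ (p : Ideal A) [p.IsPrime], p.height = 1 → ∀ m : M, ∃ s ∉ p, s • m = 0) :
    IsPseudoNull A M where
  finite := ‹_›
  isTorsion := hM
  two_le_height := by
    rw [Ideal.height_eq_inf_minimalPrimes]
    refine le_iInf₂ fun q hq ↦ ?_
    have := hq.isPrime
    by_contra! hlt
    obtain ⟨a, ha, ha0⟩ := exists_ne_zero_mem_annihilator hM
    have hq0 : q.height ≠ 0 := fun h0 ↦ ha0 (by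
      rw [Ideal.height_eq_zero_iff_eq_bot] at h0
      simpa [h0] using hq.1.2 ha)
    have hq1 : q.height = 1 := le_antisymm
      (Order.le_of_lt_add_one (by simpa [one_add_one_eq_two] using hlt)) (Order.one_le_iff_ne_zero.mpr hq0)
    exact Module.notMem_support_iff'.mpr (h q hq1) (Module.mem_support_iff_of_finite
      (p := ⟨q, this⟩).mpr hq.1.2)

variable [IsKrullDomain A]

theorem finite_height_one_of_isTorsion [Module.Finite A M] (hM : Module.IsTorsion A M) :
    {p : PrimeSpectrum A | p.asIdeal.height = 1 ∧ Module.annihilator A M ≤ p.asIdeal}.Finite := by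
  obtain ⟨a, ha, ha0⟩ := exists_ne_zero_mem_annihilator hM
  refine (IsKrullDomain.finite_not_isUnit a ha0).subset fun p hp ↦ ⟨hp.1, ?_⟩
  rw [IsLocalization.AtPrime.isUnit_to_map_iff _ p.asIdeal]
  exact fun h ↦ h (hp.2 ha)

/-- A finitely generated torsion module over a noetherian Krull domain is pseudo-isomorphic to an
elementary module. -/
theorem exists_isElementaryProduct [IsNoetherianRing A] [Module.Finite A M] (hM : Module.IsTorsion A M) :
    ∃ I, IsElementaryProduct A M I := by
  classical
  let T := {p : PrimeSpectrum A | p.asIdeal.height = 1 ∧ Module.annihilator A M ≤ p.asIdeal}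
  have : Finite T := finite_height_one_of_isTorsion hM
  have := Fintype.ofFinite T
  have key (p : T) := by
    have := IsKrullDomain.isDiscreteValuationRing p.1 p.2.1
    exact exists_locally_bijective_of_isTorsion hM p.1.asIdeal
  choose d k f hk hker hcoker using key
  let ι := Σ p : T, Fin (d p)
  let q : ι → Ideal A := fun i ↦ i.1.1.asIdeal
  let e : ι → ℕ := fun i ↦ k i.1 i.2
  have hq (i : ι) : (q i).IsPrime := i.1.1.2
  have hq1 (i : ι) : (q i).height = 1 := i.1.2.1
  let F : M →ₗ[A] ∀ i, A ⧸ q i ^ e i := .pi fun i ↦ .proj i.2 ∘ₗ f i.1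
  -- A single element outside `p` kills all factors at the other primes, so only the `p`-part of `F`
  -- matters locally at `p`.
  have hkill (p : Ideal A) [p.IsPrime] (hp : p.height = 1) :
      ∃ s ∉ p, ∀ i, q i ≠ p → ∀ x : A ⧸ q i ^ e i, s • x = 0 := by
    have h1 (i : ι) : ∃ s ∉ p, q i ≠ p → s ∈ q i ^ e i := by
      by_cases h : q i = p
      · exact ⟨1, p.primeCompl.one_mem, fun h' ↦ absurd h h'⟩
      · obtain ⟨s, hs, hsp⟩ := exists_mem_pow_notMem hp (hq1 i) h (e i)
        exact ⟨s, hsp, fun _ ↦ hs⟩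
    choose s hs hs' using h1
    refine ⟨∏ i, s i, fun h ↦ ?_, fun i hi x ↦ ?_⟩
    · obtain ⟨i, -, hi⟩ := (Ideal.IsPrime.prod_mem_iff (hp := ‹_›)).mp h
      exact hs i hi
    · obtain ⟨a, rfl⟩ := Submodule.Quotient.mk_surjective _ x
      rw [← Submodule.Quotient.mk_smul, Submodule.Quotient.mk_eq_zero]
      exact Ideal.mul_mem_right _ _
        (Ideal.mem_of_dvd _ (Finset.dvd_prod_of_mem s (Finset.mem_univ i)) (hs' i hi))
  have hFker (p : Ideal A) [hpp : p.IsPrime] (hp : p.height = 1) (x : M) (hx : F x = 0) :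
      ∃ s ∉ p, s • x = 0 := by
    by_cases hpT : (⟨p, hpp⟩ : PrimeSpectrum A) ∈ T
    · exact hker ⟨_, hpT⟩ x (funext fun j ↦ congrFun hx ⟨⟨_, hpT⟩, j⟩)
    · obtain ⟨s, hs, hsp⟩ := Set.not_subset.mp fun h ↦ hpT ⟨hp, h⟩
      exact ⟨s, hsp, Module.mem_annihilator.mp hs x⟩
  have hFcoker (p : Ideal A) [hpp : p.IsPrime] (hp : p.height = 1) (y) :
      ∃ s ∉ p, ∃ x, F x = s • y := by
    obtain ⟨s, hs, hsk⟩ := hkill p hp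
    by_cases hpT : (⟨p, hpp⟩ : PrimeSpectrum A) ∈ T
    · obtain ⟨t, ht, x, hx⟩ := hcoker ⟨_, hpT⟩ fun j ↦ y ⟨⟨_, hpT⟩, j⟩
      refine ⟨s * t, p.primeCompl.mul_mem hs ht, s • x, funext fun i ↦ ?_⟩
      rw [map_smul, mul_smul, Pi.smul_apply, Pi.smul_apply]
      by_cases hi : q i = p
      · obtain ⟨⟨⟨r, hr⟩, hrT⟩, j⟩ := i
        change r = p at hi
        subst hi
        exact congrArg (s • ·) (congrFun hx j)
      · rw [hsk i hi, hsk i hi]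
    · refine ⟨s, hs, 0, funext fun i ↦ ?_⟩
      rw [map_zero, Pi.smul_apply, hsk i, Pi.zero_apply]
      rintro rfl
      exact hpT i.1.2
  have hN : Module.IsTorsion A (∀ i, A ⧸ q i ^ e i) := by
    have h1 (i : ι) : ∃ s ∈ q i ^ e i, s ≠ 0 :=
      Submodule.exists_mem_ne_zero_of_ne_bot
        (pow_ne_zero _ (Ideal.ne_bot_of_height_eq_one (hq1 i)))
    choose s hs hs0 using h1
    intro y
    refine ⟨⟨∏ i, s i, mem_nonZeroDivisors_of_ne_zero
      (Finset.prod_ne_zero_iff.mpr fun i _ ↦ hs0 i)⟩, funext fun i ↦ ?_⟩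
    change (∏ i, s i) • y i = 0
    obtain ⟨a, ha⟩ := Submodule.Quotient.mk_surjective _ (y i)
    rw [← ha, ← Submodule.Quotient.mk_smul, Submodule.Quotient.mk_eq_zero]
    exact Ideal.mul_mem_right _ _
      (Ideal.mem_of_dvd _ (Finset.dvd_prod_of_mem s (Finset.mem_univ i)) (hs i))
  let σ := (Fintype.equivFin ι).symm
  let E : (∀ i, A ⧸ q i ^ e i) ≃ₗ[A] ∀ j, A ⧸ q (σ j) ^ e (σ j) :=
    (LinearEquiv.piCongrLeft A (fun i ↦ A ⧸ q i ^ e i) σ).symm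
  refine ⟨_, _, q ∘ σ, e ∘ σ, fun j ↦ ⟨hq _, hq1 _, hk _ _⟩, ⟨E.toLinearMap ∘ₗ F, ?_, ?_⟩, rfl⟩
  · refine isPseudoNull_of_locally_zero (fun x ↦ ?_) fun p _ hp x ↦ ?_
    · obtain ⟨a, ha⟩ := @hM x.1
      exact ⟨a, Subtype.ext ha⟩
    · obtain ⟨s, hs, h⟩ := hFker p hp x.1 (E.map_eq_zero_iff.mp x.2)
      exact ⟨s, hs, Subtype.ext h⟩
  · refine isPseudoNull_of_locally_zero (fun y ↦ ?_) fun p _ hp y ↦ ?_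
    · obtain ⟨y, rfl⟩ := Submodule.Quotient.mk_surjective _ y
      obtain ⟨a, ha⟩ := @hN (E.symm y)
      refine ⟨a, ?_⟩
      have : (a : A) • y = 0 := by
        apply E.symm.injective
        rw [map_smul, map_zero]
        exact ha
      exact congrArg Submodule.Quotient.mk this
    · obtain ⟨y, rfl⟩ := Submodule.Quotient.mk_surjective _ y
      obtain ⟨s, hs, x, hx⟩ := hFcoker p hp (E.symm y)
      refine ⟨s, hs, ?_⟩
      rw [← Submodule.Quotient.mk_smul, Submodule.Quotient.mk_eq_zero]
      exact ⟨x, by simp [hx]⟩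

end Existence

/-! ### Heights in `A⟦X⟧` and modules killed by `X`. -/

section PowerSeries

open PowerSeries

variable {A : Type*} [CommRing A]

/-- The height of the prime `(p, X)` of `A⟦X⟧` is at most 2 if `p` has height 1. -/
theorem height_comap_constantCoeff_le_two [IsDomain A] [IsNoetherianRing A] {p : Ideal A}
    [p.IsPrime] (hp : p.height = 1) :
    (p.comap (constantCoeff (R := A))).height ≤ 2 := by
  obtain ⟨x, hxp, hx0⟩ := Submodule.exists_mem_ne_zero_of_ne_bot (Ideal.ne_bot_of_height_eq_one hp)
  have hmin : p.comap (constantCoeff (R := A)) ∈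
      (Ideal.span ({X, C x} : Set A⟦X⟧)).minimalPrimes := by
    refine ⟨⟨inferInstance, ?_⟩, fun Q ⟨hQ, hXQ⟩ hQp ↦ ?_⟩
    · rw [Ideal.span_le]
      rintro f (rfl | rfl)
      · simp
      · simpa using hxp
    · have hX : (X : A⟦X⟧) ∈ Q := hXQ (Ideal.subset_span (by simp))
      have hx : x ∈ Q.comap (C (R := A)) := hXQ (Ideal.subset_span (by simp))
      have hle : Q.comap (C (R := A)) ≤ p := fun a ha ↦ by simpa using hQp ha
      -- The contraction of `Q` is a prime inside `p` containing `x ≠ 0`; height one leaves only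
      -- `p`.
      have heq : Q.comap (C (R := A)) = p := by
        by_contra hne
        have h1 := Ideal.height_add_one_le_of_lt_of_isPrime (lt_of_le_of_ne hle hne)
        have h0 : (Q.comap (C (R := A))).height ≠ 0 := by
          rw [Ne, Ideal.height_eq_zero_iff_eq_bot]
          intro h
          rw [h] at hx
          exact hx0 hx
        rw [hp] at h1
        have h2 : (1 : ℕ∞) ≤ (Q.comap (C (R := A))).height := Order.one_le_iff_ne_zero.mpr h0
        exact absurd ((add_le_add_left h2 1).trans h1) (by norm_num)
      intro f hf
      rw [eq_X_mul_shift_add_const f]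
      refine Q.add_mem (Q.mul_mem_right _ hX) ?_
      rw [← heq] at hf
      exact hf
  refine (Ideal.height_le_card_of_mem_minimalPrimes_span (Set.toFinite _) hmin).trans ?_
  exact_mod_cast (Set.ncard_insert_le _ _).trans (by simp)

variable {N : Type*} [AddCommGroup N] [Module A⟦X⟧ N]

theorem X_smul_torsionBy (n : Submodule.torsionBy A⟦X⟧ N X) : (X : A⟦X⟧) • n = 0 :=
  Subtype.ext n.2

theorem X_smul_quotient (n : N ⧸ ((X : A⟦X⟧) • (⊤ : Submodule A⟦X⟧ N))) : (X : A⟦X⟧) • n = 0 := by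
  obtain ⟨n, rfl⟩ := Submodule.Quotient.mk_surjective _ n
  rw [← Submodule.Quotient.mk_smul, Submodule.Quotient.mk_eq_zero]
  exact Submodule.smul_mem_pointwise_smul _ _ _ trivial

/-- The annihilator of a module of codimension at least 2 is not contained in `(X)`. -/
theorem exists_mem_annihilator_constantCoeff_ne_zero [IsDomain A] [IsNoetherianRing A]
    (h : 2 ≤ (Module.annihilator A⟦X⟧ N).height) :
    ∃ f ∈ Module.annihilator A⟦X⟧ N, constantCoeff f ≠ 0 := by
  by_contra! H
  have h1 : Module.annihilator A⟦X⟧ N ≤ Ideal.span {X} := fun f hf ↦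
    Ideal.mem_span_singleton.mpr (X_dvd_iff.mpr (H f hf))
  have := h.trans ((Ideal.height_mono h1).trans
    (Ideal.height_span_singleton_le_one fun hX ↦
      not_isUnit_zero (M₀ := A) (by simpa using hX.map (constantCoeff (R := A)))))
  exact absurd this (by norm_num)

variable [Module A N] [IsScalarTower A A⟦X⟧ N]

theorem constantCoeff_smul_of_X_smul_eq_zero (f : A⟦X⟧) {n : N} (hn : (X : A⟦X⟧) • n = 0) :
    constantCoeff f • n = f • n := by
  conv_rhs => rw [eq_shift_mul_X_add_const f]
  rw [add_smul, mul_smul, hn, smul_zero, zero_add, ← algebraMap_smul A⟦X⟧ (constantCoeff f) n]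
  rfl

/-- A finitely generated `A⟦X⟧`-module killed by `X` is finitely generated over `A`. -/
theorem finite_of_X_smul_eq_zero [Module.Finite A⟦X⟧ N] (h : ∀ n : N, (X : A⟦X⟧) • n = 0) :
    Module.Finite A N := by
  obtain ⟨s, hs⟩ := Module.Finite.fg_top (R := A⟦X⟧) (M := N)
  refine ⟨s, eq_top_iff.mpr fun n _ ↦ ?_⟩
  have hn : n ∈ Submodule.span A⟦X⟧ (s : Set N) := hs ▸ Submodule.mem_top
  induction hn using Submodule.span_induction with
  | mem x hx => exact Submodule.subset_span hx
  | zero => exact zero_mem _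
  | add x y _ _ hx hy => exact add_mem (hx trivial) (hy trivial)
  | smul f x _ hx =>
    rw [← constantCoeff_smul_of_X_smul_eq_zero f (h x)]
    exact Submodule.smul_mem _ _ (hx trivial)

theorem isTorsion_of_X_smul_eq_zero [IsDomain A] (h : ∀ n : N, (X : A⟦X⟧) • n = 0)
    (H : ∃ f ∈ Module.annihilator A⟦X⟧ N, constantCoeff f ≠ 0) : Module.IsTorsion A N := by
  obtain ⟨f, hf, hf0⟩ := H
  intro n
  refine ⟨⟨_, mem_nonZeroDivisors_of_ne_zero hf0⟩, ?_⟩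
  exact (constantCoeff_smul_of_X_smul_eq_zero f (h n)).trans (Module.mem_annihilator.mp hf n)

end PowerSeries

/-! ### The six-term sequence of multiplication by `t`. -/

section TorsionSequence

variable {R : Type*} [CommRing R] (t : R) {N₁ N₂ N₃ : Type*} [AddCommGroup N₁] [Module R N₁]
  [AddCommGroup N₂] [Module R N₂] [AddCommGroup N₃] [Module R N₃]

/-- The map induced on `t`-torsion by a linear map. -/
def torsionByMap (f : N₁ →ₗ[R] N₂) : Submodule.torsionBy R N₁ t →ₗ[R] Submodule.torsionBy R N₂ t :=
  f.restrict fun x hx ↦ by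
    rw [Submodule.mem_torsionBy_iff] at hx ⊢
    rw [← map_smul, hx, map_zero]

/-- The map induced on quotients by multiples of `t` by a linear map. -/
def quotSMulMap (f : N₁ →ₗ[R] N₂) :
    (N₁ ⧸ (t • (⊤ : Submodule R N₁))) →ₗ[R] N₂ ⧸ (t • (⊤ : Submodule R N₂)) :=
  Submodule.mapQ _ _ f <| by
    rintro _ ⟨x, -, rfl⟩
    exact ⟨f x, trivial, (map_smul f t x).symm⟩

theorem exact_torsionBy_lsmul (N : Type*) [AddCommGroup N] [Module R N] :
    Function.Exact (Submodule.torsionBy R N t).subtype (LinearMap.lsmul R N t) := by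
  rw [LinearMap.exact_iff, Submodule.range_subtype]
  rfl

theorem exact_lsmul_quotSMul (N : Type*) [AddCommGroup N] [Module R N] :
    Function.Exact (LinearMap.lsmul R N t) (t • (⊤ : Submodule R N)).mkQ := by
  rw [LinearMap.exact_iff, Submodule.ker_mkQ, LinearMap.range_eq_map]
  rfl

variable {t}

theorem torsionByMap_injective {f : N₁ →ₗ[R] N₂} (hf : Function.Injective f) :
    Function.Injective (torsionByMap t f) :=
  fun _ _ h ↦ Subtype.ext (hf (congrArg Subtype.val h))

theorem quotSMulMap_surjective {f : N₁ →ₗ[R] N₂} (hf : Function.Surjective f) :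
    Function.Surjective (quotSMulMap t f) := by
  intro y
  obtain ⟨y, rfl⟩ := Submodule.Quotient.mk_surjective _ y
  obtain ⟨x, rfl⟩ := hf y
  exact ⟨Submodule.Quotient.mk x, rfl⟩

variable {f : N₁ →ₗ[R] N₂} {g : N₂ →ₗ[R] N₃}

theorem torsionByMap_exact (hf : Function.Injective f) (h : Function.Exact f g) :
    Function.Exact (torsionByMap t f) (torsionByMap t g) := by
  rintro ⟨y, hy⟩
  constructor
  · intro hgy
    obtain ⟨x, rfl⟩ := (h y).mp (congrArg Subtype.val hgy)
    refine ⟨⟨x, ?_⟩, rfl⟩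
    rw [Submodule.mem_torsionBy_iff] at hy ⊢
    exact hf (by rw [map_smul, hy, map_zero])
  · rintro ⟨x, hx⟩
    rw [← hx]
    exact Subtype.ext (h.apply_apply_eq_zero x.1)

theorem quotSMulMap_exact (hg : Function.Surjective g) (h : Function.Exact f g) :
    Function.Exact (quotSMulMap t f) (quotSMulMap t g) := by
  intro y
  obtain ⟨y, rfl⟩ := Submodule.Quotient.mk_surjective _ y
  constructor
  · intro hy
    obtain ⟨z, -, hz⟩ := (Submodule.Quotient.mk_eq_zero _).mp hy
    obtain ⟨w, rfl⟩ := hg z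
    change t • g w = g y at hz
    obtain ⟨x, hx⟩ := (h (y - t • w)).mp (by rw [map_sub, map_smul, hz, sub_self])
    refine ⟨Submodule.Quotient.mk x, ?_⟩
    change Submodule.Quotient.mk (f x) = _
    rw [hx, Submodule.Quotient.eq]
    refine ⟨-w, trivial, ?_⟩
    change t • -w = _
    rw [smul_neg]
    abel
  · rintro ⟨x, hx⟩
    obtain ⟨x, rfl⟩ := Submodule.Quotient.mk_surjective _ x
    rw [← hx]
    exact congrArg Submodule.Quotient.mk (h.apply_apply_eq_zero x)

/-- This is the snake lemma for multiplication by `t` on a short exact sequence. -/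
theorem exists_connecting_torsionBy_quotSMul (hf : Function.Injective f)
    (hg : Function.Surjective g) (h : Function.Exact f g) :
    ∃ δ : Submodule.torsionBy R N₃ t →ₗ[R] N₁ ⧸ (t • (⊤ : Submodule R N₁)),
      Function.Exact (torsionByMap t g) δ ∧ Function.Exact δ (quotSMulMap t f) := by
  have h₁ : f.comp (LinearMap.lsmul R N₁ t) = (LinearMap.lsmul R N₂ t).comp f := by
    ext; simp
  have h₂ : g.comp (LinearMap.lsmul R N₂ t) = (LinearMap.lsmul R N₃ t).comp g := by
    ext; simp
  exact ⟨SnakeLemma.δ' _ _ _ f g h f g h h₁ h₂ _ (exact_torsionBy_lsmul t N₃) _ (exact_lsmul_quotSMul t N₁) hg hf,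
    SnakeLemma.exact_δ'_right _ _ _ f g h f g h h₁ h₂ _ (exact_torsionBy_lsmul t N₂) _ (exact_torsionBy_lsmul t N₃) _ (exact_lsmul_quotSMul t N₁) hg hf
      _ rfl (Submodule.subtype_injective _),
    SnakeLemma.exact_δ'_left _ _ _ f g h f g h h₁ h₂ _ (exact_torsionBy_lsmul t N₃) _ (exact_lsmul_quotSMul t N₁) _ (exact_lsmul_quotSMul t N₂) hg hf
      _ rfl (Submodule.mkQ_surjective _)⟩

/-- Additivity of the Euler characteristic of multiplication by `t`. -/
theorem localLength_torsionBy_add_quotSMul {A : Type*} [CommRing A] [Algebra A R]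
    [Module A N₁] [IsScalarTower A R N₁] [Module A N₂] [IsScalarTower A R N₂]
    [Module A N₃] [IsScalarTower A R N₃] (p : Ideal A) [p.IsPrime] (t : R)
    (hf : Function.Injective f) (hg : Function.Surjective g) (h : Function.Exact f g) :
    localLength p (Submodule.torsionBy R N₁ t) + localLength p (Submodule.torsionBy R N₃ t) +
        localLength p (N₂ ⧸ (t • (⊤ : Submodule R N₂))) =
      localLength p (Submodule.torsionBy R N₂ t) + localLength p (N₁ ⧸ (t • (⊤ : Submodule R N₁))) +
        localLength p (N₃ ⧸ (t • (⊤ : Submodule R N₃))) := by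
  obtain ⟨δ, hδ, hδ'⟩ := exists_connecting_torsionBy_quotSMul (t := t) hf hg h
  let f₁ := (torsionByMap t f).restrictScalars A
  let f₂ := (torsionByMap t g).restrictScalars A
  let f₃ := δ.restrictScalars A
  let f₄ := (quotSMulMap t f).restrictScalars A
  let f₅ := (quotSMulMap t g).restrictScalars A
  have h₁ : Function.Injective f₁ := torsionByMap_injective hf
  have h₁₂ : Function.Exact f₁ f₂ := torsionByMap_exact (t := t) hf h
  have h₂₃ : Function.Exact f₂ f₃ := hδ
  have h₃₄ : Function.Exact f₃ f₄ := hδ'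
  have h₄₅ : Function.Exact f₄ f₅ := quotSMulMap_exact (t := t) hg h
  have h₅ : Function.Surjective f₅ := quotSMulMap_surjective (t := t) hg
  exact localLength_six_term p h₁ h₁₂ h₂₃ h₃₄ h₄₅ h₅

end TorsionSequence

/-! ### Dévissage and the equality of characteristic ideals. -/

section Main

open PowerSeries

variable {A : Type*} [CommRing A]

variable [IsDomain A] [IsNoetherianRing A]

section

variable {N : Type*} [AddCommGroup N] [Module A⟦X⟧ N] [Module A N] [IsScalarTower A A⟦X⟧ N]

instance finite_torsionBy_X [Module.Finite A⟦X⟧ N] :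
    Module.Finite A (Submodule.torsionBy A⟦X⟧ N X) :=
  finite_of_X_smul_eq_zero X_smul_torsionBy

instance finite_quotient_X [Module.Finite A⟦X⟧ N] :
    Module.Finite A (N ⧸ ((X : A⟦X⟧) • (⊤ : Submodule A⟦X⟧ N))) :=
  finite_of_X_smul_eq_zero X_smul_quotient

theorem isTorsion_torsionBy_X (h : 2 ≤ (Module.annihilator A⟦X⟧ N).height) :
    Module.IsTorsion A (Submodule.torsionBy A⟦X⟧ N X) := by
  obtain ⟨f, hf, hf0⟩ := exists_mem_annihilator_constantCoeff_ne_zero h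
  exact isTorsion_of_X_smul_eq_zero X_smul_torsionBy
    ⟨f, (Submodule.subtype _).annihilator_le_of_injective Subtype.val_injective hf, hf0⟩

theorem isTorsion_quotient_X (h : 2 ≤ (Module.annihilator A⟦X⟧ N).height) :
    Module.IsTorsion A (N ⧸ ((X : A⟦X⟧) • (⊤ : Submodule A⟦X⟧ N))) := by
  obtain ⟨f, hf, hf0⟩ := exists_mem_annihilator_constantCoeff_ne_zero h
  exact isTorsion_of_X_smul_eq_zero X_smul_quotient
    ⟨f, (Submodule.mkQ _).annihilator_le_of_surjective (Submodule.mkQ_surjective _) hf, hf0⟩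

end

/-- The case of a quotient of `A⟦X⟧` by a prime of height at least 2. -/
theorem localLength_torsionBy_X_eq_of_equiv_quotient_prime {p : Ideal A} [p.IsPrime]
    (hp : p.height = 1) {N : Type*} [AddCommGroup N] [Module A⟦X⟧ N]
    [Module A N] [IsScalarTower A A⟦X⟧ N] (h : 2 ≤ (Module.annihilator A⟦X⟧ N).height)
    (q : Ideal A⟦X⟧) [hq : q.IsPrime] (e : N ≃ₗ[A⟦X⟧] A⟦X⟧ ⧸ q) :
    localLength p (Submodule.torsionBy A⟦X⟧ N X) =
      localLength p (N ⧸ ((X : A⟦X⟧) • (⊤ : Submodule A⟦X⟧ N))) := by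
  have hann : Module.annihilator A⟦X⟧ N = q := by rw [e.annihilator_eq, Ideal.annihilator_quotient]
  by_cases hX : (X : A⟦X⟧) ∈ q
  · have hXN (n : N) : (X : A⟦X⟧) • n = 0 := by
      rw [← hann] at hX
      exact Module.mem_annihilator.mp hX n
    have h1 : Submodule.torsionBy A⟦X⟧ N X = ⊤ := eq_top_iff.mpr fun n _ ↦ hXN n
    have h2 : (X : A⟦X⟧) • (⊤ : Submodule A⟦X⟧ N) = ⊥ := by
      rw [eq_bot_iff]
      rintro _ ⟨n, -, rfl⟩
      exact hXN n
    rw [localLength_congr p ((LinearEquiv.ofTop _ h1).restrictScalars A),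
      localLength_congr p ((Submodule.quotEquivOfEqBot _ h2).restrictScalars A)]
  · obtain ⟨b, hbq, hbp⟩ : ∃ b ∈ q, constantCoeff b ∉ p := by
      by_contra! H
      have hlt : q < p.comap (constantCoeff (R := A)) := by
        refine lt_of_le_of_ne (fun b hb ↦ H b hb) fun heq ↦ hX ?_
        rw [heq]
        simp
      have h1 := (Ideal.height_add_one_le_of_lt_of_isPrime hlt).trans
        (height_comap_constantCoeff_le_two hp)
      rw [hann] at h
      exact absurd ((add_le_add_left h 1).trans h1) (by norm_num)
    rw [localLength_eq_zero p, localLength_eq_zero p]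
    · intro n
      refine ⟨_, hbp, ?_⟩
      rw [constantCoeff_smul_of_X_smul_eq_zero b (X_smul_quotient n)]
      obtain ⟨n, rfl⟩ := Submodule.Quotient.mk_surjective _ n
      rw [← Submodule.Quotient.mk_smul, Module.mem_annihilator.mp (hann ▸ hbq) n,
        Submodule.Quotient.mk_zero]
    -- `X` is a nonzerodivisor modulo `q`, so the torsion vanishes even before localizing.
    · rintro ⟨n, hn⟩
      refine ⟨1, p.primeCompl.one_mem, ?_⟩
      rw [one_smul]
      refine Subtype.ext (e.map_eq_zero_iff.mp ?_)
      obtain ⟨a, ha⟩ := Ideal.Quotient.mk_surjective (e n)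
      have h0 : e ((X : A⟦X⟧) • n) = 0 := by
        rw [(Submodule.mem_torsionBy_iff _ _).mp hn, map_zero]
      rw [map_smul, ← ha, ← Ideal.Quotient.mk_eq_mk, ← Submodule.Quotient.mk_smul,
        Submodule.Quotient.mk_eq_zero] at h0
      rw [← ha, Ideal.Quotient.eq_zero_iff_mem]
      exact (hq.mem_or_mem h0).resolve_left hX

variable [IsKrullDomain A]

/-- Over a prime of height one, the kernel and cokernel of multiplication by `X` on a module of
codimension at least 2 have the same length. -/
theorem localLength_torsionBy_X_eq {p : Ideal A} [p.IsPrime]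
    (hp : p.height = 1) {N : Type*} [AddCommGroup N] [Module A⟦X⟧ N]
    [Module A N] [IsScalarTower A A⟦X⟧ N] [hN : Module.Finite A⟦X⟧ N]
    (h : 2 ≤ (Module.annihilator A⟦X⟧ N).height) :
    localLength p (Submodule.torsionBy A⟦X⟧ N X) =
      localLength p (N ⧸ ((X : A⟦X⟧) • (⊤ : Submodule A⟦X⟧ N))) := by
  -- The induction runs over `A⟦X⟧`-modules, so the height bound and the compatible `A`-structure
  -- must be quantified inside it.
  revert ‹Module A N›
  revert h
  induction hN using IsNoetherianRing.induction_on_isQuotientEquivQuotientPrime A⟦X⟧ with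
  | subsingleton N =>
    intro _ _ _
    rw [localLength_eq_zero p fun m ↦ ⟨1, p.primeCompl.one_mem, Subsingleton.elim _ _⟩,
      localLength_eq_zero p fun m ↦ ⟨1, p.primeCompl.one_mem, Subsingleton.elim _ _⟩]
  | quotient N q e =>
    intro h _ _
    have := q.2
    exact localLength_torsionBy_X_eq_of_equiv_quotient_prime hp h q.1 e
  | exact N₁ N₂ N₃ f g hf hg hfg ih₁ ih₃ =>
    intro h _ _
    have hN₁ := h.trans (Ideal.height_mono (f.annihilator_le_of_injective hf))
    have hN₃ := h.trans (Ideal.height_mono (g.annihilator_le_of_surjective hg))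
    let _ : Module A N₁ := Module.compHom N₁ (algebraMap A A⟦X⟧)
    let _ : Module A N₃ := Module.compHom N₃ (algebraMap A A⟦X⟧)
    have : IsScalarTower A A⟦X⟧ N₁ := .of_algebraMap_smul fun _ _ ↦ rfl
    have : IsScalarTower A A⟦X⟧ N₃ := .of_algebraMap_smul fun _ _ ↦ rfl
    have key := localLength_torsionBy_add_quotSMul p (X : A⟦X⟧) hf hg hfg
    -- The outer terms have finite length, so they can be cancelled from `key` once the induction
    -- hypotheses identify them.
    obtain ⟨I₁, hI₁⟩ := exists_isElementaryProduct (isTorsion_quotient_X hN₁)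
    obtain ⟨I₃, hI₃⟩ := exists_isElementaryProduct (isTorsion_quotient_X hN₃)
    have h₁ := hI₁.localLength_ne_top p hp
    have h₃ := hI₃.localLength_ne_top p hp
    rw [ih₁ hN₁, ih₃ hN₃, add_assoc (localLength p (Submodule.torsionBy A⟦X⟧ N₂ X)),
      add_comm (localLength p (Submodule.torsionBy A⟦X⟧ N₂ X))] at key
    exact (WithTop.add_left_cancel (WithTop.add_ne_top.mpr ⟨h₁, h₃⟩) key).symm

theorem charIdeal_eq_of_localLength_eq {M N : Type*} [AddCommGroup M] [Module A M]
    [AddCommGroup N] [Module A N] [Module.Finite A M] [Module.Finite A N]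
    (hM : Module.IsTorsion A M) (hN : Module.IsTorsion A N)
    (h : ∀ (p : Ideal A) [p.IsPrime], p.height = 1 → localLength p M = localLength p N) :
    charIdeal A M = charIdeal A N := by
  have hM' := exists_isElementaryProduct hM
  have hN' := exists_isElementaryProduct hN
  rw [charIdeal, dif_pos ⟨hM, hM'⟩, charIdeal, dif_pos ⟨hN, hN'⟩]
  exact hM'.choose_spec.eq_of_localLength_eq hN'.choose_spec h

end Main

theorem proposition2p4 {A : Type*} [CommRing A] [IsDomain A] [IsNoetherianRing A]
    [IsKrullDomain A] {P : Type*} [AddCommGroup P] [Module A⟦X⟧ P]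
    [Module A P] [IsScalarTower A A⟦X⟧ P] (hP : IsPseudoNull A⟦X⟧ P) :
    Module.Finite A (Submodule.torsionBy A⟦X⟧ P PowerSeries.X) ∧
    Module.IsTorsion A (Submodule.torsionBy A⟦X⟧ P PowerSeries.X) ∧
    Module.Finite A (P ⧸ ((PowerSeries.X : A⟦X⟧) • (⊤ : Submodule A⟦X⟧ P))) ∧
    Module.IsTorsion A (P ⧸ ((PowerSeries.X : A⟦X⟧) • (⊤ : Submodule A⟦X⟧ P))) ∧
    charIdeal A (Submodule.torsionBy A⟦X⟧ P PowerSeries.X) =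
      charIdeal A (P ⧸ ((PowerSeries.X : A⟦X⟧) • (⊤ : Submodule A⟦X⟧ P))) := by
  have := hP.finite
  have h₁ := isTorsion_torsionBy_X hP.two_le_height
  have h₂ := isTorsion_quotient_X hP.two_le_height
  exact ⟨inferInstance, h₁, inferInstance, h₂, charIdeal_eq_of_localLength_eq h₁ h₂
    fun _ _ hp ↦ localLength_torsionBy_X_eq hp hP.two_le_height⟩
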